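/- Let $F$ be a field, let $m\ge 0$ be an integer and let $A\in\mathfrak{gl}(m,F)=M_m(F)$. Write $\mathrm{ad}\,A$ for the $F$-linear operator $B\mapsto AB-BA$ on $M_m(F)$. Then the conditions (C1) all eigenvalues of $\mathrm{ad}\,A$ (in an algebraic closure of $F$) lie in $F$, (C2) the eigenvalues of $\mathrm{ad}\,A$ form a subfield of $F$, (C3) the centralizer of $A$ in $M_m(F)$ is a field, all hold if and only if the following three conditions all hold: (C4) $F$ has prime characteristic $p$, (C5) $A$ is similar to the companion matrix of a monic irreducible polynomial $h\in F[X]$ of degree $m$, (C6) if $q\in F[X]$ is the separable part of $h$, i.e. $q$ is separable and $h(X)=q(X^{p^e})$ with $e\ge 0$, then $q=X^{p^n}-X-a$ for some $a\in F$ and $n\ge 1$ such that $F$ contains a subfield $\mathbb F_{p^n}$ with $p^n$ elements. Moreover, if (C4)-(C6) hold, with $p$, $h$, $q$, $e$, $n$, $a$ as there, then: - $q$ is irreducible; - the set of eigenvalues of $\mathrm{ad}\,A$ is precisely the subfield $\mathbb F_{p^n}$ of $F$; - all eigenvectors of $\mathrm{ad}\,A$ are invertible in $M_m(F)$; - all eigenspaces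 of $\mathrm{ad}\,A$ have dimension $p^{n+e}$ over $F$; - $\mathrm{ad}\,A$ is diagonalizable over $F$ if and only if $h$ is separable, equivalently if and only if $e=0$; - the invariant factors of $\mathrm{ad}\,A$ are $X^{p^{n+e}}-X^{p^e},\dots,X^{p^{n+e}}-X^{p^e}$, with multiplicity $p^{n+e}$; that is, $M_m(F)$, viewed as an $F[X]$-module with $X$ acting as $\mathrm{ad}\,A$, is isomorphic to the direct sum of $p^{n+e}$ copies of $F[X]/(X^{p^{n+e}}-X^{p^e})$; - in particular, the minimal polynomial of $\mathrm{ad}\,A$ is $X^{p^{n+e}}-X^{p^e}$. -/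

import Mathlib

open Polynomial

noncomputable section

/-- The operator `ad A : gl(m, F) → gl(m, F)`, `B ↦ A * B - B * A`. -/
def adMat {F : Type*} [Field F] {m : ℕ} (A : Matrix (Fin m) (Fin m) F) :
    Module.End F (Matrix (Fin m) (Fin m) F) :=
  LinearMap.mulLeft F A - LinearMap.mulRight F A

/-- The `m × m` companion matrix of a polynomial `g` (meant for `g` monic of degree `m`):
ones just below the diagonal, last column `-g₀, …, -g_{m-1}`, zeros elsewhere. -/
def companionMat {F : Type*} [Field F] (m : ℕ) (g : F[X]) : Matrix (Fin m) (Fin m) F :=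
  Matrix.of fun i j =>
    if (j : ℕ) + 1 = m then -g.coeff i else if (i : ℕ) = (j : ℕ) + 1 then 1 else 0

/-- Similarity of square matrices: `B = P⁻¹ * A * P` for an invertible `P`. -/
def MatSimilar {F : Type*} [Field F] {m : ℕ} (A B : Matrix (Fin m) (Fin m) F) : Prop :=
  ∃ P : (Matrix (Fin m) (Fin m) F)ˣ, B = (P⁻¹).val * A * P.val

/-- All eigenvalues of the endomorphism `f`, taken in an algebraic closure of `F`
(that is, the eigenvalues of `f` after extension of scalars), lie in `F`. -/
def AllEigenvaluesIn {F V : Type*} [Field F] [AddCommGroup V] [Module F V]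
    (f : Module.End F V) : Prop :=
  ∀ μ : AlgebraicClosure F,
    Module.End.HasEigenvalue (LinearMap.baseChange (AlgebraicClosure F) f) μ →
      ∃ b : F, algebraMap F (AlgebraicClosure F) b = μ

/-- The set of eigenvalues in `F` of an endomorphism. -/
def eigenvalueSet {F V : Type*} [Field F] [AddCommGroup V] [Module F V]
    (f : Module.End F V) : Set F :=
  {b | Module.End.HasEigenvalue f b}

/-- An endomorphism is diagonalizable if there is a basis consisting of eigenvectors
(indexed by some set `s` of vectors). -/
def IsDiagonalizableEnd {F V : Type*} [Field F] [AddCommGroup V] [Module F V]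
    (f : Module.End F V) : Prop :=
  ∃ (s : Set V) (b : Module.Basis s F V), ∀ i : s, ∃ c : F, f (b i) = c • b i

/-- `d 0 ∣ d 1 ∣ ⋯ ∣ d (k - 1)` are the invariant factors of the endomorphism `f`: they are monic
and nonconstant, each divides the next, and `V`, viewed as an `F[X]`-module with `X` acting
as `f`, is isomorphic to the product of the cyclic modules `F[X] / (d i)`. -/
structure HasInvariantFactors {F V : Type*} [Field F] [AddCommGroup V] [Module F V]
    (f : Module.End F V) {k : ℕ} (d : Fin k → F[X]) : Prop where
  monic : ∀ i, (d i).Monic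
  natDegree_pos : ∀ i, 0 < (d i).natDegree
  dvd : ∀ i j, i ≤ j → d i ∣ d j
  equiv : Nonempty (Module.AEval' f ≃ₗ[F[X]] ((i : Fin k) → F[X] ⧸ Ideal.span {d i}))

/-- `q` is the separable part of `h` with exponent `e`: `h(X) = q(X ^ (p ^ e))`,
where `q` is separable. -/
structure IsSeparablePart {F : Type*} [Field F] (p : ℕ) (h q : F[X]) (e : ℕ) : Prop where
  separable : q.Separable
  expand_eq : h = expand F (p ^ e) q

/-- `F` has prime characteristic `p`; the matrix `A` is similar to the companion matrix of the
monic irreducible polynomial `h` of degree `m`; the separable part `q` of `h`, with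
`h(X) = q(X ^ (p ^ e))`, is `X ^ (p ^ n) - X - a` with `n ≥ 1`; and `K` is a
subfield of `F` with `p ^ n` elements. -/
structure IsGenArtinSchreier {F : Type*} [Field F] {m : ℕ} (A : Matrix (Fin m) (Fin m) F)
    (p : ℕ) (h q : F[X]) (e n : ℕ) (a : F) (K : Subfield F) : Prop where
  prime : p.Prime
  charP : CharP F p
  monic : h.Monic
  irreducible : Irreducible h
  natDegree_eq : h.natDegree = m
  similar : MatSimilar A (companionMat m h)
  sepPart : IsSeparablePart p h q e
  one_le : 1 ≤ n
  q_eq : q = X ^ (p ^ n) - X - C a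
  card_eq : Nat.card K = p ^ n

end

/-!
The centralizer of `A` is a field exactly when `A` acts irreducibly on `F ^ m`, i.e. when the
minimal polynomial `h` of `A` is irreducible of degree `m`. Then every nonzero `B` with
`A * B = B * (A + c)` is invertible by Schur's lemma, so `h` is invariant under translation by the
eigenvalues `c` of `ad A`.

Since `ad` commutes with `p`-power maps, `X ^ p ^ i - X ^ p ^ j` kills `ad A` if and only if its
value at `A` is a scalar. If the eigenvalues of `ad A` form a subfield `K` of order `p ^ n`, then
`(X ^ p ^ n - X) ^ p ^ k` kills `ad A` for large `k`, so `(α ^ p ^ n - α) ^ p ^ k ∈ F` for a root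
`α` of `h`. With `β = α ^ p ^ e` a root of the separable part `q`, the element `β ^ p ^ n - β` is
both separable and purely inseparable over `F`, hence lies in `F`; comparing with the `p ^ n` roots
`β + c` of `q` gives `q = X ^ p ^ n - X - a`.

Conversely, the transpose of `A` also acts irreducibly, which makes the rank-one matrices
`x * wᵀ` with `w` fixed generate `M_m(F)` over `F[X]`, where `X` acts as `ad A`. So `M_m(F)` is
generated by `m` elements killed by the polynomial `X ^ p ^ (n + e) - X ^ p ^ e` of degree `m`, and
by dimension count it is free over the quotient. Everything else is read off the minimal polynomial
`X ^ p ^ (n + e) - X ^ p ^ e = (∏ c ∈ K, (X - c)) ^ p ^ e`.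
-/

section Polynomial

theorem aeval_mul_eq_mul_aeval {R S : Type*} [CommSemiring R] [Semiring S] [Algebra R S]
    {a b u : S} (h : a * u = u * b) (r : R[X]) : aeval a r * u = u * aeval b r := by
  induction r using Polynomial.induction_on' with
  | add r s hr hs => rw [map_add, map_add, add_mul, mul_add, hr, hs]
  | monomial k c =>
    have hpow : a ^ k * u = u * b ^ k :=
      (SemiconjBy.pow_right (show SemiconjBy u b a from h.symm) k).symm
    rw [aeval_monomial, aeval_monomial, mul_assoc, hpow, ← mul_assoc, ← mul_assoc,
      Algebra.commutes]

theorem minpoly_comp_X_add_C {F S : Type*} [Field F] [Ring S] [Algebra F S] {a u : S} {c : F}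
    (ha : IsIntegral F a) (hu : IsUnit u) (h : a * u = u * (a + algebraMap F S c)) :
    (minpoly F a).comp (X + C c) = minpoly F a := by
  have hroot : aeval a ((minpoly F a).comp (X + C c)) = 0 := by
    rw [aeval_comp, map_add, aeval_X, aeval_C, ← hu.mul_right_eq_zero, ← aeval_mul_eq_mul_aeval h,
      minpoly.aeval, zero_mul]
  refine eq_of_monic_of_dvd_of_natDegree_le (minpoly.monic ha)
    ((minpoly.monic ha).comp_X_add_C c) (minpoly.dvd F a hroot) ?_
  rw [natDegree_comp, natDegree_X_add_C, mul_one]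

theorem X_pow_sub_X_pow_eq_pow {R : Type*} [CommRing R] (p : ℕ) [ExpChar R p] (n e : ℕ) :
    (X ^ p ^ (n + e) - X ^ p ^ e : R[X]) = (X ^ p ^ n - X) ^ p ^ e := by
  rw [sub_pow_expChar_pow, ← pow_mul, pow_add]

end Polynomial

section Module

theorem isSimpleModule_of_isIdempotentElem_eq_zero_or_one {R M : Type*} [Ring R] [AddCommGroup M]
    [Module R M] [Nontrivial M] [IsSemisimpleModule R M]
    (h : ∀ P : Module.End R M, IsIdempotentElem P → P = 0 ∨ P = 1) : IsSimpleModule R M where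
  eq_bot_or_eq_top W := by
    obtain ⟨W', hW⟩ := exists_isCompl W
    rw [← Submodule.range_projection hW]
    rcases h _ (Submodule.isIdempotentElem_projection hW) with h₀ | h₁
    · exact .inl (h₀ ▸ LinearMap.range_zero)
    · exact .inr (h₁ ▸ LinearMap.range_id)

variable {F V : Type*} [Field F] [AddCommGroup V] [Module F V]

theorem nonempty_aeval'_linearEquiv_pi_quotient [FiniteDimensional F V] {ι : Type*} [Fintype ι]
    {f : Module.End F V} {P : F[X]} (hP : P ≠ 0) (hfP : aeval f P = 0)
    (hrank : Module.finrank F V = Fintype.card ι * P.natDegree) {x : ι → Module.AEval' f}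
    (hx : Submodule.span F[X] (Set.range x) = ⊤) :
    Nonempty (Module.AEval' f ≃ₗ[F[X]] (ι → F[X] ⧸ Ideal.span {P})) := by
  classical
  have hann (i) : Ideal.span {P} ≤ LinearMap.ker (LinearMap.toSpanSingleton F[X] _ (x i)) := by
    rw [Ideal.span_singleton_le_iff_mem]
    change P • x i = 0
    rw [← (Module.AEval'.of f).apply_symm_apply (x i), ← Module.AEval.of_aeval_smul, hfP,
      zero_smul, map_zero]
  let Φ : (ι → F[X] ⧸ Ideal.span {P}) →ₗ[F[X]] Module.AEval' f :=
    LinearMap.lsum F[X] _ F[X] fun i => (Ideal.span {P}).liftQ _ (hann i)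
  have hsurj : Function.Surjective Φ := by
    rw [← LinearMap.range_eq_top, eq_top_iff, ← hx, Submodule.span_le]
    rintro _ ⟨i, rfl⟩
    refine ⟨Pi.single i (Submodule.Quotient.mk 1), ?_⟩
    rw [LinearMap.lsum_piSingle, Submodule.liftQ_apply, LinearMap.toSpanSingleton_apply, one_smul]
  have hfin : Module.Finite F (F[X] ⧸ Ideal.span {P}) := (AdjoinRoot.powerBasis hP).finite
  have hfinrank : Module.finrank F (ι → F[X] ⧸ Ideal.span {P}) =
      Module.finrank F (Module.AEval' f) := by
    rw [← (Module.AEval'.of f).finrank_eq, hrank, Module.finrank_pi_fintype, Finset.sum_const,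
      finrank_quotient_span_eq_natDegree, smul_eq_mul, Finset.card_univ]
  have hinj : Function.Injective (Φ.restrictScalars F) :=
    (LinearMap.injective_iff_surjective_of_finrank_eq_finrank hfinrank).2 hsurj
  exact ⟨(LinearEquiv.ofBijective Φ ⟨hinj, hsurj⟩).symm⟩

theorem HasInvariantFactors.minpoly_eq {f : Module.End F V} {k : ℕ} {d : Fin k → F[X]}
    (H : HasInvariantFactors f d) {i : Fin k} (hi : ∀ j, d j ∣ d i) : minpoly F f = d i := by
  obtain ⟨E⟩ := H.equiv
  have hspan : Ideal.span {minpoly F f} = Ideal.span {d i} := by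
    rw [span_minpoly_eq_annihilator, E.annihilator_eq, Module.annihilator_pi]
    simp only [Ideal.annihilator_quotient]
    exact le_antisymm (iInf_le _ i) <|
      le_iInf fun j => Ideal.span_singleton_le_span_singleton.2 (hi j)
  have hassoc := Ideal.span_singleton_eq_span_singleton.1 hspan
  have hint : IsIntegral F f :=
    minpoly.ne_zero_iff.1 (hassoc.ne_zero_iff.2 (H.monic i).ne_zero)
  exact eq_of_monic_of_associated (minpoly.monic hint) (H.monic i) hassoc

theorem mem_eigenvalueSet_iff [FiniteDimensional F V] {f : Module.End F V} {c : F} :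
    c ∈ eigenvalueSet f ↔ (minpoly F f).IsRoot c :=
  Module.End.hasEigenvalue_iff_isRoot

theorem allEigenvaluesIn_iff_splits_minpoly [FiniteDimensional F V] {f : Module.End F V} :
    AllEigenvaluesIn f ↔ (minpoly F f).Splits := by
  have hmin : minpoly F f ≠ 0 := minpoly.ne_zero (Algebra.IsIntegral.isIntegral f)
  constructor
  · intro hf
    refine Splits.of_splits_map _ (IsAlgClosed.splits _) fun μ hμ => hf μ ?_
    rw [Module.End.hasEigenvalue_iff_isRoot_charpoly, LinearMap.charpoly_baseChange]
    exact (isRoot_of_mem_roots hμ).dvd (Polynomial.map_dvd _ (LinearMap.minpoly_dvd_charpoly f))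
  · intro hs μ hμ
    refine hs.mem_range_of_isRoot hmin (i := algebraMap F (AlgebraicClosure F)) ?_
    obtain ⟨x, hx⟩ := hμ.exists_hasEigenvector
    have hzero : aeval (LinearMap.baseChange (AlgebraicClosure F) f)
        ((minpoly F f).map (algebraMap F (AlgebraicClosure F))) = 0 := by
      rw [aeval_map_algebraMap]
      change aeval (Module.End.baseChangeHom F (AlgebraicClosure F) V f) _ = 0
      rw [aeval_algHom_apply, minpoly.aeval, map_zero]
    have := Module.End.aeval_apply_of_hasEigenvector hx
      (p := (minpoly F f).map (algebraMap F (AlgebraicClosure F)))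
    rw [hzero, LinearMap.zero_apply, eq_comm, smul_eq_zero_iff_left hx.2] at this
    exact this

theorem ker_aeval_prod_X_sub_C_le_span (f : Module.End F V) (s : Finset F) :
    LinearMap.ker (aeval f (∏ c ∈ s, (X - C c))) ≤ Submodule.span F {v | ∃ c : F, f v = c • v} := by
  classical
  induction s using Finset.induction_on with
  | empty => simp [Module.End.one_eq_id]
  | insert a s ha ih =>
    rw [Finset.prod_insert ha, ← sup_ker_aeval_eq_ker_aeval_mul_of_coprime]
    · refine sup_le (fun v hv => Submodule.subset_span ⟨a, ?_⟩) ih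
      simpa [sub_eq_zero] using hv
    · refine IsCoprime.prod_right fun c hc => isCoprime_X_sub_C_of_isUnit_sub ?_
      exact (sub_ne_zero.2 (ne_of_mem_of_not_mem hc ha).symm).isUnit

theorem isDiagonalizableEnd_of_aeval_prod_X_sub_C_eq_zero {f : Module.End F V} {s : Finset F}
    (hf : aeval f (∏ c ∈ s, (X - C c)) = 0) : IsDiagonalizableEnd f := by
  have hspan : ⊤ ≤ Submodule.span F {v | ∃ c : F, f v = c • v} := by
    simpa only [hf, LinearMap.ker_zero] using ker_aeval_prod_X_sub_C_le_span f s
  exact ⟨_, Module.Basis.ofSpan hspan, fun i => Module.Basis.ofSpan_subset hspan ⟨i, rfl⟩⟩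

theorem isDiagonalizableEnd_iff_splits_and_separable_minpoly [FiniteDimensional F V]
    {f : Module.End F V} :
    IsDiagonalizableEnd f ↔ (minpoly F f).Splits ∧ (minpoly F f).Separable := by
  classical
  constructor
  · rintro ⟨_, b, hb⟩
    set s : Finset F := f.finite_hasEigenvalue.toFinset
    have hzero : aeval f (∏ c ∈ s, (X - C c)) = 0 := by
      refine b.ext fun i => ?_
      obtain ⟨c, hc⟩ := hb i
      have hv : f.HasEigenvector c (b i) := ⟨Module.End.mem_eigenspace_iff.2 hc, b.ne_zero i⟩
      have hcs : c ∈ s :=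
        f.finite_hasEigenvalue.mem_toFinset.2 (Module.End.hasEigenvalue_of_hasEigenvector hv)
      rw [Module.End.aeval_apply_of_hasEigenvector hv, eval_prod,
        Finset.prod_eq_zero hcs (by simp), zero_smul, LinearMap.zero_apply]
    have hdvd := minpoly.dvd F f hzero
    exact ⟨(Splits.prod fun c _ => Splits.X_sub_C c).of_dvd
      (Finset.prod_ne_zero_iff.2 fun c _ => X_sub_C_ne_zero c) hdvd,
      (separable_prod_X_sub_C_iff'.2 fun _ _ _ _ h => h).of_dvd hdvd⟩
  · rintro ⟨hs, hsep⟩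
    refine isDiagonalizableEnd_of_aeval_prod_X_sub_C_eq_zero
      (s := ⟨(minpoly F f).roots, nodup_roots hsep⟩) ?_
    change aeval f ((minpoly F f).roots.map (X - C ·)).prod = 0
    rw [← hs.eq_prod_roots_of_monic (minpoly.monic (Algebra.IsIntegral.isIntegral f)),
      minpoly.aeval]

end Module

section Cyclic

variable {F V : Type*} [Field F] [AddCommGroup V] [Module F V] [FiniteDimensional F V]

theorem nonempty_aeval'_linearEquiv_quotient {f : Module.End F V} {h : F[X]}
    (hirr : Irreducible h) (hf : aeval f h = 0) (hdeg : h.natDegree = Module.finrank F V) :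
    Nonempty (Module.AEval' f ≃ₗ[F[X]] F[X] ⧸ Ideal.span {h}) := by
  have : Nontrivial V := Module.finrank_pos_iff (R := F).1 (hdeg ▸ hirr.natDegree_pos)
  obtain ⟨v, hv⟩ := exists_ne (0 : V)
  have hmax : (Ideal.span {h}).IsMaximal := PrincipalIdealRing.isMaximal_of_irreducible hirr
  have hsimple : IsSimpleModule F[X] (F[X] ⧸ Ideal.span {h}) :=
    isSimpleModule_iff_quot_maximal.2 ⟨_, hmax, ⟨.refl _ _⟩⟩
  have hann : Ideal.span {h} ≤
      LinearMap.ker (LinearMap.toSpanSingleton F[X] _ (Module.AEval'.of f v)) := by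
    rw [Ideal.span_singleton_le_iff_mem, LinearMap.mem_ker, LinearMap.toSpanSingleton_apply,
      ← Module.AEval.of_aeval_smul, hf, zero_smul, map_zero]
  set Φ := (Ideal.span {h}).liftQ _ hann with hΦdef
  have hΦ : Φ ≠ 0 := fun h₀ => hv <| by
    have := LinearMap.congr_fun h₀ (Submodule.Quotient.mk 1)
    rwa [hΦdef, Submodule.liftQ_apply, LinearMap.toSpanSingleton_apply, one_smul,
      LinearMap.zero_apply, LinearEquiv.map_eq_zero_iff] at this
  have hinj : Function.Injective Φ := LinearMap.injective_of_ne_zero hΦ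
  have hfin : Module.Finite F (F[X] ⧸ Ideal.span {h}) :=
    (AdjoinRoot.powerBasis hirr.ne_zero).finite
  have hfinrank : Module.finrank F (F[X] ⧸ Ideal.span {h}) =
      Module.finrank F (Module.AEval' f) := by
    rw [finrank_quotient_span_eq_natDegree, hdeg, (Module.AEval'.of f).finrank_eq]
  have hsurj : Function.Surjective (Φ.restrictScalars F) :=
    (LinearMap.injective_iff_surjective_of_finrank_eq_finrank hfinrank).1 hinj
  exact ⟨(LinearEquiv.ofBijective Φ ⟨hinj, hsurj⟩).symm⟩

theorem isSimpleModule_aeval'_iff {f : Module.End F V} :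
    IsSimpleModule F[X] (Module.AEval' f) ↔
      Irreducible (minpoly F f) ∧ (minpoly F f).natDegree = Module.finrank F V := by
  constructor
  · intro hsimple
    obtain ⟨I, hI, ⟨E⟩⟩ := isSimpleModule_iff_quot_maximal.1 hsimple
    have hspan : Ideal.span {minpoly F f} = I := by
      rw [span_minpoly_eq_annihilator, E.annihilator_eq, Ideal.annihilator_quotient]
    subst hspan
    refine ⟨((Ideal.span_singleton_prime (minpoly.ne_zero (Algebra.IsIntegral.isIntegral f))).1
      hI.isPrime).irreducible, ?_⟩
    rw [← finrank_quotient_span_eq_natDegree, ← (E.restrictScalars F).finrank_eq,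
      (Module.AEval'.of f).finrank_eq]
  · rintro ⟨hirr, hdeg⟩
    exact isSimpleModule_iff_quot_maximal.2 ⟨_, PrincipalIdealRing.isMaximal_of_irreducible hirr,
      nonempty_aeval'_linearEquiv_quotient hirr (minpoly.aeval F f) hdeg⟩

end Cyclic

theorem aeval_toLin' {R ι : Type*} [CommRing R] [Fintype ι] [DecidableEq ι] (A : Matrix ι ι R)
    (r : R[X]) : aeval A.toLin' r = (aeval A r).toLin' :=
  aeval_algHom_apply (Matrix.toLinAlgEquiv' : _ ≃ₐ[R] _).toAlgHom A r

section Companion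

variable {F : Type*} [Field F] {m : ℕ}

theorem companionMat_natDegree {h : F[X]} (hmon : h.Monic) :
    companionMat h.natDegree h =
      Algebra.leftMulMatrix (AdjoinRoot.powerBasis' hmon).basis (AdjoinRoot.root h) := by
  have hgen : (AdjoinRoot.powerBasis' hmon).minpolyGen = h := by
    rw [PowerBasis.minpolyGen_eq, AdjoinRoot.powerBasis'_gen, AdjoinRoot.minpoly_root hmon.ne_zero,
      hmon.leadingCoeff, inv_one, C_1, mul_one]
  have hmat := (AdjoinRoot.powerBasis' hmon).leftMulMatrix
  rw [hgen] at hmat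
  exact hmat.symm

theorem aeval_companionMat_natDegree {h : F[X]} (hmon : h.Monic) :
    aeval (companionMat h.natDegree h) h = 0 := by
  rw [companionMat_natDegree hmon]
  refine (aeval_algHom_apply (Algebra.leftMulMatrix (AdjoinRoot.powerBasis' hmon).basis)
    (AdjoinRoot.root h) h).trans ?_
  rw [AdjoinRoot.aeval_eq, AdjoinRoot.mk_self]
  exact map_zero _

theorem MatSimilar.aeval_eq_zero {A B : Matrix (Fin m) (Fin m) F} (hAB : MatSimilar A B) {r : F[X]}
    (hB : aeval B r = 0) : aeval A r = 0 := by
  obtain ⟨P, hP⟩ := hAB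
  have hAP : A * P.val = P.val * B := by rw [hP, mul_assoc, Units.mul_inv_cancel_left]
  rw [← P.isUnit.mul_left_eq_zero, aeval_mul_eq_mul_aeval hAP, hB, mul_zero]

theorem matSimilar_toMatrix (A : Matrix (Fin m) (Fin m) F)
    (b : Module.Basis (Fin m) F (Fin m → F)) :
    MatSimilar A (LinearMap.toMatrix b b A.toLin') := by
  let e := Pi.basisFun F (Fin m)
  refine ⟨⟨e.toMatrix b, b.toMatrix e, e.toMatrix_mul_toMatrix_flip b,
    b.toMatrix_mul_toMatrix_flip e⟩, ?_⟩
  have hA : LinearMap.toMatrix e e A.toLin' = A := LinearMap.toMatrix'_toLin' A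
  have hbasis := basis_toMatrix_mul_linearMap_toMatrix_mul_basis_toMatrix b e b e A.toLin'
  rw [hA] at hbasis
  exact hbasis.symm

theorem matSimilar_companionMat {A : Matrix (Fin m) (Fin m) F} {h : F[X]} (hirr : Irreducible h)
    (hmon : h.Monic) (hdeg : h.natDegree = m) (hA : aeval A h = 0) :
    MatSimilar A (companionMat m h) := by
  subst hdeg
  have hA' : aeval A.toLin' h = 0 := by rw [aeval_toLin', hA, map_zero]
  obtain ⟨E⟩ := nonempty_aeval'_linearEquiv_quotient hirr hA' (by simp)
  let G : AdjoinRoot h ≃ₗ[F] (Fin h.natDegree → F) :=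
    (E.restrictScalars F).symm.trans (Module.AEval'.of A.toLin').symm
  have hG (x : AdjoinRoot h) : G (AdjoinRoot.root h * x) = A.toLin' (G x) := by
    obtain ⟨g, rfl⟩ := AdjoinRoot.mk_surjective x
    rw [← AdjoinRoot.mk_X, ← map_mul]
    exact (congrArg (Module.AEval'.of A.toLin').symm
      (E.symm.map_smul X (Ideal.Quotient.mk _ g))).trans (Module.AEval.of_symm_X_smul _ _)
  let b := (AdjoinRoot.powerBasis' hmon).basis
  have hb : LinearMap.toMatrix (b.map G) (b.map G) A.toLin' = companionMat h.natDegree h := by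
    rw [companionMat_natDegree hmon]
    ext i j
    rw [LinearMap.toMatrix_apply, Module.Basis.map_apply, ← hG, Module.Basis.map_repr,
      LinearEquiv.trans_apply, LinearEquiv.symm_apply_apply]
    exact (Algebra.leftMulMatrix_eq_repr_mul b (AdjoinRoot.root h) i j).symm
  exact hb ▸ matSimilar_toMatrix A (b.map G)

end Companion

section ActsIrreducibly

open scoped Matrix

variable {F ι : Type*} [Field F] [Fintype ι] [DecidableEq ι] {A : Matrix ι ι F}

/-- The matrix `A` acts irreducibly: no subspace of `F ^ ι` other than `0` and `F ^ ι` is mapped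
into itself by `A`, and `F ^ ι ≠ 0`. It is encoded as simplicity of the `F[X]`-module `F ^ ι` on
which `X` acts as `A`. -/
def ActsIrreducibly (A : Matrix ι ι F) : Prop :=
  IsSimpleModule F[X] (Module.AEval' A.toLin')

theorem actsIrreducibly_iff :
    ActsIrreducibly A ↔ Irreducible (minpoly F A) ∧ (minpoly F A).natDegree = Fintype.card ι := by
  rw [ActsIrreducibly, isSimpleModule_aeval'_iff, Matrix.minpoly_toLin',
    Module.finrank_fintype_fun_eq_card]

theorem ActsIrreducibly.nonempty (hA : ActsIrreducibly A) : Nonempty ι :=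
  Fintype.card_pos_iff.1 ((actsIrreducibly_iff.1 hA).2 ▸ (actsIrreducibly_iff.1 hA).1.natDegree_pos)

theorem actsIrreducibly_of_aeval_eq_zero {h : F[X]} (hirr : Irreducible h) (hmon : h.Monic)
    (hdeg : h.natDegree = Fintype.card ι) (hA : aeval A h = 0) : ActsIrreducibly A := by
  have : Nonempty ι := Fintype.card_pos_iff.1 (hdeg ▸ hirr.natDegree_pos)
  rw [actsIrreducibly_iff, ← minpoly.eq_of_irreducible_of_monic hirr hA hmon]
  exact ⟨hirr, hdeg⟩

theorem aeval_transpose {R : Type*} [CommRing R] (A : Matrix ι ι R) (r : R[X]) :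
    aeval A.transpose r = (aeval A r).transpose :=
  MulOpposite.op_injective <|
    (aeval_op_apply _ r).symm.trans
      (aeval_algHom_apply (Matrix.transposeAlgEquiv ι R R).toAlgHom A r)

theorem ActsIrreducibly.transpose (hA : ActsIrreducibly A) : ActsIrreducibly A.transpose := by
  have hirr := actsIrreducibly_iff.1 hA
  refine actsIrreducibly_of_aeval_eq_zero hirr.1
    (minpoly.monic (Algebra.IsIntegral.isIntegral A)) hirr.2 ?_
  rw [aeval_transpose, minpoly.aeval, Matrix.transpose_zero]

theorem ActsIrreducibly.eq_bot_or_eq_top (hA : ActsIrreducibly A) {W : Submodule F (ι → F)}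
    (hW : ∀ v ∈ W, A *ᵥ v ∈ W) : W = ⊥ ∨ W = ⊤ := by
  have : IsSimpleModule F[X] (Module.AEval' A.toLin') := hA
  have : IsSimpleOrder (Module.End.invtSubmodule A.toLin') :=
    (Module.AEval.mapSubmodule F (ι → F) A.toLin').isSimpleOrder
  exact (IsSimpleOrder.eq_bot_or_eq_top (⟨W, hW⟩ : Module.End.invtSubmodule A.toLin')).imp
    (congrArg Subtype.val) (congrArg Subtype.val)

theorem ActsIrreducibly.exists_aeval_mulVec_eq (hA : ActsIrreducibly A) {v : ι → F} (hv : v ≠ 0)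
    (w : ι → F) : ∃ r : F[X], aeval A r *ᵥ v = w := by
  have : IsSimpleModule F[X] (Module.AEval' A.toLin') := hA
  obtain ⟨r, hr⟩ := IsSimpleModule.toSpanSingleton_surjective F[X]
    ((Module.AEval'.of A.toLin').map_ne_zero_iff.2 hv) (Module.AEval'.of A.toLin' w)
  rw [LinearMap.toSpanSingleton_apply, ← Module.AEval.of_aeval_smul, aeval_toLin',
    EmbeddingLike.apply_eq_iff_eq] at hr
  exact ⟨r, hr⟩

theorem ActsIrreducibly.isUnit_of_mul_eq_mul (hA : ActsIrreducibly A) {A' B : Matrix ι ι F}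
    (hB : B ≠ 0) (h : A' * B = B * A) : IsUnit B := by
  have hker : LinearMap.ker B.toLin' = ⊥ ∨ LinearMap.ker B.toLin' = ⊤ :=
    hA.eq_bot_or_eq_top fun v (hv : B *ᵥ v = 0) => show B *ᵥ A *ᵥ v = 0 by
      rw [Matrix.mulVec_mulVec, ← h, ← Matrix.mulVec_mulVec, hv, Matrix.mulVec_zero]
  rcases hker with hbot | htop
  · exact Matrix.mulVec_injective_iff_isUnit.1 (LinearMap.ker_eq_bot.1 hbot)
  · exact absurd (Matrix.toLin'.map_eq_zero_iff.1 (LinearMap.ker_eq_top.1 htop)) hB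

theorem ActsIrreducibly.exists_aeval_eq_of_commute (hA : ActsIrreducibly A) {B : Matrix ι ι F}
    (hAB : Commute A B) : ∃ r : F[X], aeval A r = B := by
  have := hA.nonempty
  obtain ⟨v, hv⟩ := exists_ne (0 : ι → F)
  obtain ⟨r, hr⟩ := hA.exists_aeval_mulVec_eq hv (B *ᵥ v)
  refine ⟨r, sub_eq_zero.1 (by_contra fun hne => hv ?_)⟩
  have hcomm : Commute A (aeval A r - B) :=
    .sub_right (aeval_mul_eq_mul_aeval (Commute.refl A).eq r).symm hAB
  have hunit := hA.isUnit_of_mul_eq_mul hne hcomm.eq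
  refine Matrix.mulVec_injective_of_isUnit hunit ?_
  rw [Matrix.sub_mulVec, hr, sub_self, Matrix.mulVec_zero]

theorem ActsIrreducibly.isField_centralizer (hA : ActsIrreducibly A) :
    IsField (Subalgebra.centralizer F {A}) where
  exists_pair_ne := by
    have := hA.nonempty
    exact exists_pair_ne _
  mul_comm := by
    rintro ⟨B, hB⟩ ⟨C, hC⟩
    obtain ⟨r, rfl⟩ := hA.exists_aeval_eq_of_commute (hB A rfl)
    obtain ⟨s, rfl⟩ := hA.exists_aeval_eq_of_commute (hC A rfl)
    exact Subtype.ext (Commute.map (mul_comm r s : Commute r s) (aeval A)).eq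
  mul_inv_cancel := by
    rintro ⟨B, hB⟩ hne
    have hcomm : Commute A B := hB A rfl
    obtain ⟨u, rfl⟩ := hA.isUnit_of_mul_eq_mul (fun h₀ => hne (Subtype.ext h₀)) hcomm.eq
    refine ⟨⟨↑u⁻¹, ?_⟩, Subtype.ext u.mul_inv⟩
    rintro _ rfl
    exact hcomm.units_inv_right.eq

theorem irreducible_minpoly_of_isDomain_centralizer [IsDomain (Subalgebra.centralizer F {A})] :
    Irreducible (minpoly F A) := by
  let a : Subalgebra.centralizer F {A} := ⟨A, by rintro _ rfl; rfl⟩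
  have ha : minpoly F A = minpoly F a :=
    minpoly.algHom_eq (Subalgebra.centralizer F {A}).val Subtype.val_injective a
  exact ha ▸ minpoly.irreducible (Algebra.IsIntegral.isIntegral a)

theorem actsIrreducibly_of_isDomain_centralizer [IsDomain (Subalgebra.centralizer F {A})] :
    ActsIrreducibly A := by
  have : IsSemisimpleModule F[X] (Module.AEval' A.toLin') :=
    Module.End.isSemisimple_of_squarefree_aeval_eq_zero
      irreducible_minpoly_of_isDomain_centralizer.squarefree
      (by rw [aeval_toLin', minpoly.aeval, map_zero])
  have : Nonempty ι := not_isEmpty_iff.1 fun _ =>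
    not_subsingleton (Subalgebra.centralizer F {A}) ⟨fun B C => Subtype.ext (Subsingleton.elim _ _)⟩
  have : Nontrivial (Module.AEval' A.toLin') := (Module.AEval'.of A.toLin').injective.nontrivial
  refine isSimpleModule_of_isIdempotentElem_eq_zero_or_one fun P hP => ?_
  let of := Module.AEval'.of A.toLin'
  let T : Module.End F (ι → F) := of.symm ∘ₗ P.restrictScalars F ∘ₗ of
  have hT (v : ι → F) : of (T v) = P (of v) := of.apply_symm_apply _
  have hcomm : Commute (Matrix.toLinAlgEquiv' A) T := LinearMap.ext fun v => of.injective <| by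
    rw [Module.End.mul_apply, Module.End.mul_apply, hT]
    refine (Module.AEval'.X_smul_of A.toLin' _).symm.trans ?_
    rw [hT, ← map_smul, Module.AEval'.X_smul_of]
    rfl
  have hidem : IsIdempotentElem T := LinearMap.ext fun v => of.injective <| by
    rw [Module.End.mul_apply, hT, hT, ← Module.End.mul_apply, hP.eq]
  let B : Subalgebra.centralizer F {A} := ⟨LinearMap.toMatrixAlgEquiv' T, by
    rintro _ rfl
    simpa only [LinearMap.toMatrixAlgEquiv'_toLinAlgEquiv'] using
      (hcomm.map LinearMap.toMatrixAlgEquiv').eq⟩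
  have hB : IsIdempotentElem B := Subtype.ext (hidem.map LinearMap.toMatrixAlgEquiv').eq
  refine (IsIdempotentElem.iff_eq_zero_or_one.1 hB).imp (fun h₀ => ?_) fun h₁ => ?_
  · have hT₀ : T = 0 := LinearMap.toMatrixAlgEquiv'.map_eq_zero_iff.1 (congrArg Subtype.val h₀)
    refine LinearMap.ext fun x => ?_
    rw [← of.apply_symm_apply x, ← hT, hT₀]
    exact map_zero of
  · have hT₁ : T = 1 := LinearMap.toMatrixAlgEquiv'.map_eq_one_iff.1 (congrArg Subtype.val h₁)
    refine LinearMap.ext fun x => ?_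
    rw [← of.apply_symm_apply x, ← hT, hT₁]
    rfl

theorem isField_centralizer_iff :
    IsField (Subalgebra.centralizer F {A}) ↔ ActsIrreducibly A :=
  ⟨fun hF => have := hF.isDomain; actsIrreducibly_of_isDomain_centralizer,
    fun hA => hA.isField_centralizer⟩

end ActsIrreducibly

section AdMat

open scoped Matrix

variable {F : Type*} [Field F] {m : ℕ} {A B : Matrix (Fin m) (Fin m) F} {c : F}

theorem adMat_apply (A B : Matrix (Fin m) (Fin m) F) : adMat A B = A * B - B * A := rfl

theorem adMat_apply_eq_smul_iff :
    adMat A B = c • B ↔ A * B = B * (A + algebraMap F _ c) := by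
  rw [adMat_apply, mul_add, ← Algebra.commutes, ← Algebra.smul_def, sub_eq_iff_eq_add, add_comm]

theorem adMat_sub (A B : Matrix (Fin m) (Fin m) F) : adMat (A - B) = adMat A - adMat B :=
  LinearMap.ext fun M => by
    rw [LinearMap.sub_apply, adMat_apply, adMat_apply, adMat_apply, sub_mul, mul_sub]
    abel

theorem adMat_pow_expChar_pow (p : ℕ) [ExpChar F p] (A : Matrix (Fin m) (Fin m) F) (i : ℕ) :
    adMat A ^ p ^ i = adMat (A ^ p ^ i) := by
  rcases isEmpty_or_nonempty (Fin m) with hm | hm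
  · exact LinearMap.ext fun M => Subsingleton.elim _ _
  have : ExpChar (Module.End F (Matrix (Fin m) (Fin m) F)) p :=
    expChar_of_injective_algebraMap (FaithfulSMul.algebraMap_injective F _) p
  rw [adMat, sub_pow_expChar_pow_of_commute _ _ (LinearMap.commute_mulLeft_right A A),
    LinearMap.pow_mulLeft, LinearMap.pow_mulRight, adMat]

theorem adMat_eq_zero_iff : adMat A = 0 ↔ ∃ b : F, A = algebraMap F _ b := by
  constructor
  · intro hA
    obtain ⟨b, hb⟩ := Matrix.mem_range_scalar_of_commute_single fun i j _ =>
      (sub_eq_zero.1 (LinearMap.congr_fun hA (Matrix.single i j 1))).symm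
    exact ⟨b, hb.symm⟩
  · rintro ⟨b, rfl⟩
    exact LinearMap.ext fun M => sub_eq_zero.2 (Algebra.commutes b M)

theorem aeval_adMat_X_pow_sub_X_pow_eq_zero_iff (p : ℕ) [ExpChar F p] (i j : ℕ) :
    aeval (adMat A) (X ^ p ^ i - X ^ p ^ j : F[X]) = 0 ↔
      ∃ b : F, aeval A (X ^ p ^ i - X ^ p ^ j - C b) = 0 := by
  simp only [map_sub, map_pow, aeval_X, aeval_C, adMat_pow_expChar_pow, ← adMat_sub,
    adMat_eq_zero_iff, sub_eq_zero]

theorem ActsIrreducibly.isUnit_of_hasEigenvector (hA : ActsIrreducibly A)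
    (hB : (adMat A).HasEigenvector c B) : IsUnit B := by
  refine hA.isUnit_of_mul_eq_mul (A' := A - algebraMap F _ c) hB.2 ?_
  rw [sub_mul, adMat_apply_eq_smul_iff.1 hB.apply_eq_smul, mul_add, Algebra.commutes,
    add_sub_cancel_right]

theorem ActsIrreducibly.minpoly_comp_X_add_C (hA : ActsIrreducibly A)
    (hc : (adMat A).HasEigenvalue c) : (minpoly F A).comp (X + C c) = minpoly F A := by
  obtain ⟨B, hB⟩ := hc.exists_hasEigenvector
  exact _root_.minpoly_comp_X_add_C (Algebra.IsIntegral.isIntegral A)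
    (hA.isUnit_of_hasEigenvector hB) (adMat_apply_eq_smul_iff.1 hB.apply_eq_smul)

theorem aeval_mul_mem_eigenspace_adMat (hB : B ∈ (adMat A).eigenspace c) (r : F[X]) :
    aeval A r * B ∈ (adMat A).eigenspace c := by
  rw [Module.End.mem_eigenspace_iff, adMat_apply_eq_smul_iff] at hB ⊢
  rw [← mul_assoc, ← aeval_mul_eq_mul_aeval rfl, mul_assoc, hB, mul_assoc]

theorem ActsIrreducibly.finrank_eigenspace (hA : ActsIrreducibly A)
    (hc : (adMat A).HasEigenvalue c) : Module.finrank F ((adMat A).eigenspace c) = m := by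
  have := hA.nonempty
  obtain ⟨v, hv⟩ := exists_ne (0 : Fin m → F)
  obtain ⟨B, hB⟩ := hc.exists_hasEigenvector
  have hker {M : Matrix (Fin m) (Fin m) F} (hM : IsUnit M) (hMv : M *ᵥ v = 0) : False :=
    hv (Matrix.mulVec_injective_of_isUnit hM (hMv.trans (Matrix.mulVec_zero M).symm))
  let Φ : (adMat A).eigenspace c →ₗ[F] (Fin m → F) :=
    (Matrix.mulVecBilin F F).flip v ∘ₗ ((adMat A).eigenspace c).subtype
  have hinj : Function.Injective Φ := (injective_iff_map_eq_zero Φ).2 fun M hMv =>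
    Subtype.ext (by_contra fun hne => hker (hA.isUnit_of_hasEigenvector ⟨M.2, hne⟩) hMv)
  have hsurj : Function.Surjective Φ := fun w => by
    obtain ⟨r, hr⟩ := hA.exists_aeval_mulVec_eq (hker (hA.isUnit_of_hasEigenvector hB)) w
    exact ⟨⟨aeval A r * B, aeval_mul_mem_eigenspace_adMat hB.1 r⟩,
      (Matrix.mulVec_mulVec v _ B).symm.trans hr⟩
  rw [(LinearEquiv.ofBijective Φ ⟨hinj, hsurj⟩).finrank_eq, Module.finrank_fin_fun]

theorem ActsIrreducibly.eq_top_of_forall_vecMulVec_mem (hA : ActsIrreducibly A)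
    {N : Submodule F (Matrix (Fin m) (Fin m) F)} (hN : ∀ M ∈ N, adMat A M ∈ N) {w : Fin m → F}
    (hw : w ≠ 0) (hwN : ∀ x, Matrix.vecMulVec x w ∈ N) : N = ⊤ := by
  let W : Submodule F (Fin m → F) := ⨅ x, N.comap (vecMulVecBilin F F x)
  have hW {y : Fin m → F} : y ∈ W ↔ ∀ x, Matrix.vecMulVec x y ∈ N := Submodule.mem_iInf _
  have hWtop : W = ⊤ := by
    refine (hA.transpose.eq_bot_or_eq_top fun y hy => hW.2 fun x => ?_).resolve_left
      fun hbot => hw <| (Submodule.mem_bot F).1 (hbot ▸ hW.2 hwN)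
    have hxy : Matrix.vecMulVec x (Aᵀ *ᵥ y) =
        Matrix.vecMulVec (A *ᵥ x) y - adMat A (Matrix.vecMulVec x y) := by
      rw [adMat_apply, Matrix.mul_vecMulVec, Matrix.vecMulVec_mul, Matrix.mulVec_transpose,
        sub_sub_cancel]
    exact hxy ▸ N.sub_mem (hW.1 hy _) (hN _ (hW.1 hy x))
  refine eq_top_iff.2 fun M _ => ?_
  induction M using Matrix.induction_on' with
  | h_zero => exact N.zero_mem
  | h_add M M' hM hM' => exact N.add_mem (hM trivial) (hM' trivial)
  | h_std_basis i j c =>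
    rw [← mul_one c, ← smul_eq_mul, ← Matrix.smul_single, Matrix.single_eq_single_vecMulVec_single]
    exact N.smul_mem c (hW.1 (hWtop ▸ Submodule.mem_top) _)

theorem ActsIrreducibly.span_range_vecMulVec_single_eq_top (hA : ActsIrreducibly A)
    {w : Fin m → F} (hw : w ≠ 0) :
    Submodule.span F[X] (Set.range fun i =>
      Module.AEval'.of (adMat A) (Matrix.vecMulVec (Pi.single i 1) w)) = ⊤ := by
  let of := Module.AEval'.of (adMat A)
  set N := Submodule.span F[X] (Set.range fun i => of (Matrix.vecMulVec (Pi.single i 1) w))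
  let N' : Submodule F (Matrix (Fin m) (Fin m) F) := (N.restrictScalars F).comap of.toLinearMap
  have had (M) (hM : M ∈ N') : adMat A M ∈ N' := by
    change of (adMat A M) ∈ N
    rw [← Module.AEval'.X_smul_of]
    exact N.smul_mem X hM
  let U : Submodule F (Fin m → F) := N'.comap ((vecMulVecBilin F F).flip w)
  have hU : U = ⊤ := by
    rw [eq_top_iff, ← (Pi.basisFun F (Fin m)).span_eq, Submodule.span_le]
    rintro _ ⟨i, rfl⟩
    rw [Pi.basisFun_apply]
    exact Submodule.subset_span (Set.mem_range_self i)
  have hN' : N' = ⊤ := hA.eq_top_of_forall_vecMulVec_mem had hw fun x =>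
    show x ∈ U from hU ▸ Submodule.mem_top
  refine eq_top_iff.2 fun x _ => ?_
  have hx : of.symm x ∈ N' := hN' ▸ Submodule.mem_top
  exact of.apply_symm_apply x ▸ hx

theorem ActsIrreducibly.nonempty_aeval'_adMat_linearEquiv (hA : ActsIrreducibly A) {P : F[X]}
    (hdeg : P.natDegree = m) (hP : aeval (adMat A) P = 0) :
    Nonempty (Module.AEval' (adMat A) ≃ₗ[F[X]] (Fin m → F[X] ⧸ Ideal.span {P})) := by
  have := hA.nonempty
  obtain ⟨w, hw⟩ := exists_ne (0 : Fin m → F)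
  refine nonempty_aeval'_linearEquiv_pi_quotient ?_ hP ?_ (hA.span_range_vecMulVec_single_eq_top hw)
  · exact ne_zero_of_natDegree_gt (n := 0) (hdeg ▸ Fin.pos_iff_nonempty.2 this)
  · rw [hdeg, Module.finrank_matrix, Fintype.card_fin, Module.finrank_self, mul_one]

end AdMat

section ArtinSchreier

variable {F L : Type*} [Field F] [Field L] [Algebra F L]

theorem dvd_pow_natDegree_of_splits {f g : F[X]} (hf : f.Splits) (hf0 : f ≠ 0)
    (hroot : ∀ c, f.IsRoot c → g.IsRoot c) : f ∣ g ^ f.natDegree := by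
  have hprod := Multiset.prod_dvd_prod_of_dvd (S := f.roots) (fun c => X - C c) (fun _ => g)
    fun c hc => dvd_iff_isRoot.2 (hroot c (isRoot_of_mem_roots hc))
  rw [Multiset.map_const', Multiset.prod_replicate, ← hf.natDegree_eq_card_roots] at hprod
  have hlead : IsUnit (C f.leadingCoeff) := isUnit_C.2 (leadingCoeff_ne_zero.2 hf0).isUnit
  conv_lhs => rw [hf.eq_prod_roots]
  exact hlead.mul_left_dvd.2 hprod

theorem splits_X_pow_natCard_sub_X (K : Subfield F) :
    (X ^ Nat.card K - X : F[X]).Splits := by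
  simpa using (Polynomial.splits_X_pow_nat_card_sub_X (K := K)).map K.subtype

theorem isRoot_X_pow_natCard_sub_X_iff {K : Subfield F} [Finite K] {c : F} :
    (X ^ Nat.card K - X : F[X]).IsRoot c ↔ c ∈ K := by
  refine ⟨fun hc => ?_, fun hc => ?_⟩
  · have hmap : (X ^ Nat.card K - X : K[X]).map K.subtype = X ^ Nat.card K - X := by simp
    obtain ⟨d, rfl⟩ := (Polynomial.splits_X_pow_nat_card_sub_X (K := K)).mem_range_of_isRoot
      (FiniteField.X_pow_card_sub_X_ne_zero K Finite.one_lt_card) (hmap.symm ▸ hc)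
    exact d.2
  · have := Fintype.ofFinite K
    have hpow := FiniteField.pow_card (⟨c, hc⟩ : K)
    rw [← Nat.card_eq_fintype_card] at hpow
    rw [IsRoot.def, eval_sub, eval_pow, eval_X, sub_eq_zero]
    exact congrArg Subtype.val hpow

theorem exists_natCard_eq_prime_pow (K : Subfield F) [Finite K] :
    ∃ p n : ℕ, p.Prime ∧ CharP F p ∧ 1 ≤ n ∧ Nat.card K = p ^ n := by
  have := Fintype.ofFinite K
  obtain ⟨p, _⟩ := CharP.exists K
  obtain ⟨n, hp, hn⟩ := FiniteField.card K p
  exact ⟨p, n, hp, charP_of_injective_ringHom K.subtype.injective p, n.2,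
    Nat.card_eq_fintype_card.trans hn⟩

theorem mem_range_algebraMap_of_isSeparable_of_pow_mem (p : ℕ) [ExpChar F p] {x : L}
    (hx : IsSeparable F x) {k : ℕ} (hxk : x ^ p ^ k ∈ (algebraMap F L).range) :
    x ∈ (algebraMap F L).range := by
  have hbot : x ∈ separableClosure F L ⊓ perfectClosure F L :=
    ⟨hx, (mem_perfectClosure_iff_pow_mem p).2 ⟨k, hxk⟩⟩
  rwa [separableClosure_inf_perfectClosure] at hbot

theorem expand_comp_X_add_C (p : ℕ) [ExpChar F p] (q : F[X]) (e : ℕ) (c : F) :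
    (expand F (p ^ e) q).comp (X + C c) = expand F (p ^ e) (q.comp (X + C (c ^ p ^ e))) := by
  have := expChar_of_injective_algebraMap (C_injective (R := F)) p
  simp only [expand_eq_comp_X_pow, comp_assoc, pow_comp, add_comp, X_comp, C_comp,
    add_pow_expChar_pow, C_pow]

theorem minpoly_eq_X_pow_natCard_sub_X_sub_C (K : Subfield F) [Finite K] {β : L}
    (htrans : ∀ c ∈ K, (minpoly F β).comp (X + C c) = minpoly F β) {a : F}
    (ha : β ^ Nat.card K - β = algebraMap F L a) : minpoly F β = X ^ Nat.card K - X - C a := by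
  classical
  have hcard : 1 < Nat.card K := Finite.one_lt_card
  have hmon : (X ^ Nat.card K - X - C a).Monic := by
    rw [sub_sub]
    exact monic_X_pow_sub (by rw [degree_X_add_C]; exact_mod_cast hcard)
  have hβ : aeval β (X ^ Nat.card K - X - C a) = 0 := by simp [ha]
  have hint : IsIntegral F β := ⟨_, hmon, hβ⟩
  -- All `Nat.card K` translates of `β` by `K` are roots of `minpoly F β`.
  have hdeg : Nat.card K ≤ (minpoly F β).natDegree := by
    have := Fintype.ofFinite K
    rw [Nat.card_eq_fintype_card, ← Finset.card_univ, ← natDegree_map (algebraMap F L),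
      ← Finset.card_image_of_injective (f := fun c : K => β + algebraMap F L c) Finset.univ
        fun c d hcd => Subtype.ext ((algebraMap F L).injective (add_left_cancel hcd))]
    refine card_le_degree_of_subset_roots fun x hx => ?_
    obtain ⟨c, -, rfl⟩ := Finset.mem_image.1 hx
    have hx : aeval β ((minpoly F β).comp (X + C (c : F))) =
        aeval (β + algebraMap F L c) (minpoly F β) := by
      rw [aeval_comp, map_add, aeval_X, aeval_C]
    rw [mem_roots (map_ne_zero (minpoly.ne_zero hint)), IsRoot.def, eval_map_algebraMap, ← hx,
      htrans c c.2, minpoly.aeval]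
  refine (eq_of_monic_of_dvd_of_natDegree_le (minpoly.monic hint) hmon (minpoly.dvd F β hβ) ?_).symm
  rwa [natDegree_sub_C, FiniteField.X_pow_card_sub_X_natDegree_eq F hcard]

theorem exists_eq_X_pow_natCard_sub_X_sub_C (p : ℕ) [ExpChar F p] (K : Subfield F) [Finite K]
    {q : F[X]} {e k : ℕ} {b : F} (hq : q.Separable) (hmon : q.Monic)
    (hirr : Irreducible (expand F (p ^ e) q))
    (htrans : ∀ c ∈ K, (expand F (p ^ e) q).comp (X + C c) = expand F (p ^ e) q)
    (hdvd : expand F (p ^ e) q ∣ (X ^ Nat.card K - X) ^ p ^ k - C b) :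
    ∃ a, q = X ^ Nat.card K - X - C a := by
  have hp : p ≠ 0 := (expChar_pos F p).ne'
  obtain ⟨α, hα⟩ := IsAlgClosed.exists_aeval_eq_zero (AlgebraicClosure F) _
    (degree_pos_of_irreducible hirr).ne'
  have := expChar_of_injective_algebraMap (algebraMap F (AlgebraicClosure F)).injective p
  set β := α ^ p ^ e
  have hβ : q = minpoly F β := minpoly.eq_of_irreducible_of_monic
    (of_irreducible_expand_pow hp hirr) (by rwa [← expand_aeval]) hmon
  have hβsep : IsSeparable F β := by rwa [IsSeparable, ← hβ]
  have hαb : (α ^ Nat.card K - α) ^ p ^ k = algebraMap F _ b := by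
    have := aeval_eq_zero_of_dvd_aeval_eq_zero hdvd hα
    simpa [sub_eq_zero] using this
  have hβα : β ^ Nat.card K - β = (α ^ Nat.card K - α) ^ p ^ e := by
    rw [sub_pow_expChar_pow, pow_right_comm]
  obtain ⟨a, ha⟩ : β ^ Nat.card K - β ∈ (algebraMap F (AlgebraicClosure F)).range := by
    refine mem_range_algebraMap_of_isSeparable_of_pow_mem p (k := k) ?_ ⟨b ^ p ^ e, ?_⟩
    · exact (separableClosure F (AlgebraicClosure F)).sub_mem (pow_mem hβsep _) hβsep
    · rw [hβα, pow_right_comm, hαb, map_pow]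
  refine ⟨a, hβ.trans <| minpoly_eq_X_pow_natCard_sub_X_sub_C K (fun c hc => ?_) ha.symm⟩
  have := expChar_of_injective_ringHom K.subtype.injective p
  obtain ⟨d, hd⟩ := (iterateFrobeniusEquiv K p e).surjective ⟨c, hc⟩
  have hdc : (d : F) ^ p ^ e = c := congrArg Subtype.val hd
  have hqd := htrans d d.2
  rw [expand_comp_X_add_C, hdc] at hqd
  exact hβ ▸ expand_injective (pow_pos hp.bot_lt e) hqd

end ArtinSchreier

section Classification

variable {F : Type*} [Field F] {m : ℕ} {A : Matrix (Fin m) (Fin m) F}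

theorem exists_minpoly_dvd_of_allEigenvaluesIn (p : ℕ) [Fact p.Prime] [CharP F p]
    {K : Subfield F} [Finite K] {n : ℕ} (hcard : Nat.card K = p ^ n)
    (hA : AllEigenvaluesIn (adMat A)) (hK : eigenvalueSet (adMat A) ⊆ K) :
    ∃ k b, minpoly F A ∣ (X ^ Nat.card K - X) ^ p ^ k - C b := by
  set f := minpoly F (adMat A)
  have hdvd : f ∣ (X ^ p ^ n - X) ^ p ^ f.natDegree := by
    rw [← hcard]
    exact (dvd_pow_natDegree_of_splits (allEigenvaluesIn_iff_splits_minpoly.1 hA)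
      (minpoly.ne_zero (Algebra.IsIntegral.isIntegral _)) fun c hc =>
        isRoot_X_pow_natCard_sub_X_iff.2 (hK (mem_eigenvalueSet_iff.2 hc))).trans
      (pow_dvd_pow _ (Nat.lt_pow_self (Fact.out : p.Prime).one_lt).le)
  rw [← X_pow_sub_X_pow_eq_pow] at hdvd
  obtain ⟨b, hb⟩ := (aeval_adMat_X_pow_sub_X_pow_eq_zero_iff p _ _).1
    (aeval_eq_zero_of_dvd_aeval_eq_zero hdvd (minpoly.aeval F (adMat A)))
  refine ⟨f.natDegree, b, ?_⟩
  rw [hcard, ← X_pow_sub_X_pow_eq_pow]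
  exact minpoly.dvd F A hb

theorem exists_isGenArtinSchreier (hsplit : AllEigenvaluesIn (adMat A)) {K : Subfield F}
    (hK : eigenvalueSet (adMat A) = K) (hA : ActsIrreducibly A) :
    ∃ (p : ℕ) (h q : F[X]) (e n : ℕ) (a : F) (K : Subfield F),
      IsGenArtinSchreier A p h q e n a K := by
  have : Finite K := (hK ▸ (adMat A).finite_hasEigenvalue : (K : Set F).Finite)
  obtain ⟨p, n, hp, hchar, hn, hcard⟩ := exists_natCard_eq_prime_pow K
  have : Fact p.Prime := ⟨hp⟩
  have hmon : (minpoly F A).Monic := minpoly.monic (Algebra.IsIntegral.isIntegral A)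
  obtain ⟨hirr, hdeg⟩ := actsIrreducibly_iff.1 hA
  rw [Fintype.card_fin] at hdeg
  obtain ⟨e, q, hq, hexp⟩ := exists_separable_of_irreducible p hirr hp.ne_zero
  have htrans (c) (hc : c ∈ K) : (minpoly F A).comp (X + C c) = minpoly F A :=
    hA.minpoly_comp_X_add_C (hK.symm ▸ hc : c ∈ eigenvalueSet (adMat A))
  obtain ⟨k, b, hdvd⟩ := exists_minpoly_dvd_of_allEigenvaluesIn p hcard hsplit hK.subset
  obtain ⟨a, ha⟩ := exists_eq_X_pow_natCard_sub_X_sub_C p K hq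
    ((monic_expand_iff (pow_pos hp.pos e)).1 (hexp ▸ hmon)) (hexp ▸ hirr) (hexp ▸ htrans)
    (hexp ▸ hdvd)
  exact ⟨p, minpoly F A, q, e, n, a, K, hp, hchar, hmon, hirr, hdeg,
    matSimilar_companionMat hirr hmon hdeg (minpoly.aeval F A), ⟨hq, hexp.symm⟩, hn,
    hcard ▸ ha, hcard⟩

end Classification

namespace IsGenArtinSchreier

variable {F : Type*} [Field F] {m : ℕ} {A : Matrix (Fin m) (Fin m) F} {p : ℕ} {h q : F[X]}
  {e n : ℕ} {a : F} {K : Subfield F}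

theorem irreducible_sepPart (H : IsGenArtinSchreier A p h q e n a K) : Irreducible q :=
  of_irreducible_expand_pow H.prime.ne_zero (H.sepPart.expand_eq ▸ H.irreducible)

theorem expChar (H : IsGenArtinSchreier A p h q e n a K) : ExpChar F p :=
  have := H.charP
  .prime H.prime

theorem one_lt_pow (H : IsGenArtinSchreier A p h q e n a K) : 1 < p ^ n :=
  Nat.one_lt_pow (Nat.one_le_iff_ne_zero.1 H.one_le) H.prime.one_lt

theorem finite (H : IsGenArtinSchreier A p h q e n a K) : Finite K :=
  Nat.finite_of_card_ne_zero (H.card_eq ▸ H.one_lt_pow.ne_bot)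

theorem isRoot_X_pow_sub_X_iff (H : IsGenArtinSchreier A p h q e n a K) {c : F} :
    (X ^ p ^ n - X : F[X]).IsRoot c ↔ c ∈ K := by
  have := H.finite
  rw [← H.card_eq, isRoot_X_pow_natCard_sub_X_iff]

theorem eq_X_pow_sub (H : IsGenArtinSchreier A p h q e n a K) :
    h = X ^ p ^ (n + e) - X ^ p ^ e - C a := by
  rw [H.sepPart.expand_eq, H.q_eq]
  simp only [map_sub, map_pow, expand_X, expand_C, ← pow_mul, ← pow_add, add_comm]

theorem dim_eq (H : IsGenArtinSchreier A p h q e n a K) : m = p ^ (n + e) := by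
  rw [← H.natDegree_eq, H.sepPart.expand_eq, natDegree_expand, H.q_eq, natDegree_sub_C,
    FiniteField.X_pow_card_sub_X_natDegree_eq F H.one_lt_pow, pow_add]

theorem aeval_eq_zero (H : IsGenArtinSchreier A p h q e n a K) : aeval A h = 0 := by
  obtain rfl := H.natDegree_eq
  exact H.similar.aeval_eq_zero (aeval_companionMat_natDegree H.monic)

theorem actsIrreducibly (H : IsGenArtinSchreier A p h q e n a K) : ActsIrreducibly A :=
  actsIrreducibly_of_aeval_eq_zero H.irreducible H.monic
    (H.natDegree_eq.trans (Fintype.card_fin m).symm) H.aeval_eq_zero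

theorem aeval_adMat_eq_zero (H : IsGenArtinSchreier A p h q e n a K) :
    aeval (adMat A) (X ^ p ^ (n + e) - X ^ p ^ e : F[X]) = 0 :=
  have := H.expChar
  (aeval_adMat_X_pow_sub_X_pow_eq_zero_iff p _ _).2 ⟨a, H.eq_X_pow_sub ▸ H.aeval_eq_zero⟩

theorem hasInvariantFactors (H : IsGenArtinSchreier A p h q e n a K) :
    HasInvariantFactors (adMat A)
      (fun _ : Fin (p ^ (n + e)) => (X ^ p ^ (n + e) - X ^ p ^ e : F[X])) := by
  have hlt : p ^ e < p ^ (n + e) :=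
    Nat.pow_lt_pow_right H.prime.one_lt (Nat.lt_add_of_pos_left H.one_le)
  have hdeg : (X ^ p ^ (n + e) - X ^ p ^ e : F[X]).natDegree = p ^ (n + e) :=
    natDegree_sub_eq_left_of_natDegree_lt (by simpa) |>.trans (natDegree_X_pow _)
  refine ⟨fun _ => monic_X_pow_sub (by rw [degree_X_pow]; exact_mod_cast hlt),
    fun _ => (pow_pos H.prime.pos _).trans_eq hdeg.symm, fun _ _ _ => dvd_rfl, ?_⟩
  obtain ⟨E⟩ := H.actsIrreducibly.nonempty_aeval'_adMat_linearEquiv (hdeg.trans H.dim_eq.symm)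
    H.aeval_adMat_eq_zero
  exact ⟨E.trans (LinearEquiv.funCongrLeft F[X] _ (finCongr H.dim_eq.symm))⟩

theorem minpoly_adMat (H : IsGenArtinSchreier A p h q e n a K) :
    minpoly F (adMat A) = X ^ p ^ (n + e) - X ^ p ^ e :=
  H.hasInvariantFactors.minpoly_eq (i := ⟨0, pow_pos H.prime.pos _⟩) fun _ => dvd_rfl

theorem minpoly_adMat_eq_pow (H : IsGenArtinSchreier A p h q e n a K) :
    minpoly F (adMat A) = (X ^ p ^ n - X) ^ p ^ e :=
  have := H.expChar
  H.minpoly_adMat.trans (X_pow_sub_X_pow_eq_pow p n e)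

theorem splits_minpoly_adMat (H : IsGenArtinSchreier A p h q e n a K) :
    (minpoly F (adMat A)).Splits := by
  rw [H.minpoly_adMat_eq_pow, ← H.card_eq]
  exact (splits_X_pow_natCard_sub_X K).pow _

theorem eigenvalueSet_eq (H : IsGenArtinSchreier A p h q e n a K) :
    eigenvalueSet (adMat A) = (K : Set F) := by
  ext c
  rw [mem_eigenvalueSet_iff, H.minpoly_adMat_eq_pow, IsRoot.def, eval_pow,
    pow_eq_zero_iff (pow_pos H.prime.pos e).ne', SetLike.mem_coe, ← H.isRoot_X_pow_sub_X_iff,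
    IsRoot.def]

theorem finrank_eigenspace (H : IsGenArtinSchreier A p h q e n a K) {c : F}
    (hc : (adMat A).HasEigenvalue c) :
    Module.finrank F ((adMat A).eigenspace c) = p ^ (n + e) :=
  (H.actsIrreducibly.finrank_eigenspace hc).trans H.dim_eq

theorem isDiagonalizableEnd_iff (H : IsGenArtinSchreier A p h q e n a K) :
    IsDiagonalizableEnd (adMat A) ↔ e = 0 := by
  have := H.charP
  have hsep : (X ^ p ^ n - X : F[X]).Separable :=
    galois_poly_separable p _ (dvd_pow_self p (Nat.one_le_iff_ne_zero.1 H.one_le))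
  have hnu : ¬IsUnit (X ^ p ^ n - X : F[X]) :=
    not_isUnit_of_natDegree_pos _ <|
      H.one_lt_pow.bot_lt.trans_eq (FiniteField.X_pow_card_sub_X_natDegree_eq F H.one_lt_pow).symm
  rw [isDiagonalizableEnd_iff_splits_and_separable_minpoly, and_iff_right H.splits_minpoly_adMat,
    H.minpoly_adMat_eq_pow]
  refine ⟨fun hpow => ?_, fun he => by rwa [he, pow_zero, pow_one]⟩
  have hpe : p ^ e = 1 := (Separable.of_pow hnu (pow_pos H.prime.pos e).ne' hpow).2
  exact (Nat.pow_eq_one.1 hpe).resolve_left H.prime.ne_one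

theorem separable_iff (H : IsGenArtinSchreier A p h q e n a K) : h.Separable ↔ e = 0 := by
  have := H.charP
  rw [H.sepPart.expand_eq]
  refine ⟨fun hsep => ?_, fun he => by simpa [he] using H.sepPart.separable⟩
  exact (isUnit_or_eq_zero_of_separable_expand p e H.prime.pos hsep).resolve_left
    H.irreducible_sepPart.not_isUnit

end IsGenArtinSchreier

theorem theorem1 {F : Type*} [Field F] {m : ℕ} (A : Matrix (Fin m) (Fin m) F) :
    ((AllEigenvaluesIn (adMat A) ∧
        (∃ S : Subfield F, (S : Set F) = eigenvalueSet (adMat A)) ∧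
        IsField (Subalgebra.centralizer F ({A} : Set (Matrix (Fin m) (Fin m) F)))) ↔
      ∃ (p : ℕ) (h q : F[X]) (e n : ℕ) (a : F) (K : Subfield F),
        IsGenArtinSchreier A p h q e n a K) ∧
    ∀ (p : ℕ) (h q : F[X]) (e n : ℕ) (a : F) (K : Subfield F),
      IsGenArtinSchreier A p h q e n a K →
        Irreducible q ∧
        eigenvalueSet (adMat A) = (K : Set F) ∧
        (∀ (b : F) (B : Matrix (Fin m) (Fin m) F),
          Module.End.HasEigenvector (adMat A) b B → IsUnit B) ∧
        (∀ b : F, Module.End.HasEigenvalue (adMat A) b →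
          Module.finrank F (Module.End.eigenspace (adMat A) b) = p ^ (n + e)) ∧
        (IsDiagonalizableEnd (adMat A) ↔ h.Separable) ∧
        (IsDiagonalizableEnd (adMat A) ↔ e = 0) ∧
        HasInvariantFactors (adMat A)
          (fun _ : Fin (p ^ (n + e)) => (X ^ (p ^ (n + e)) - X ^ (p ^ e) : F[X])) ∧
        minpoly F (adMat A) = X ^ (p ^ (n + e)) - X ^ (p ^ e) := by
  constructor
  · rw [isField_centralizer_iff]
    constructor
    · rintro ⟨hsplit, ⟨S, hS⟩, hA⟩
      exact exists_isGenArtinSchreier hsplit hS.symm hA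
    · rintro ⟨p, h, q, e, n, a, K, H⟩
      exact ⟨allEigenvaluesIn_iff_splits_minpoly.2 H.splits_minpoly_adMat,
        ⟨K, H.eigenvalueSet_eq.symm⟩, H.actsIrreducibly⟩
  · intro p h q e n a K H
    exact ⟨H.irreducible_sepPart, H.eigenvalueSet_eq,
      fun _ _ => H.actsIrreducibly.isUnit_of_hasEigenvector, fun _ => H.finrank_eigenspace,
      H.isDiagonalizableEnd_iff.trans H.separable_iff.symm, H.isDiagonalizableEnd_iff,
      H.hasInvariantFactors, H.minpoly_adMat⟩
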